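/- **Setting.** Let $N\ge 1$, $p\ge 0$, $n\ge 1$, $\chi\ge 0$ be integers, $x_0\in\mathbb{R}^N$, $r>0$, $\Lambda>0$, $\delta\in(0,1)$, and let $\mathcal{B}=\{x\in\mathbb{R}^N:\|x-x_0\|_\infty\le r\}$. *Hypothesis class.* For $\xi\in[-1,1]^N$ let $\Phi(\xi)\in\mathbb{R}^{(p+1)\times\cdots\times(p+1)}$ be the order-$N$ tensor with entries $\Phi(\xi)[\alpha]=\prod_{i=1}^N \xi_i^{\alpha_i}/\alpha_i!$, $\alpha\in\{0,\dots,p\}^N$. An order-$N$ tensor $A$ has TT-rank at most $\chi$ if $A[\alpha]=G_1[\alpha_1]G_2[\alpha_2]\cdots G_N[\alpha_N]$ for all $\alpha$, with real matrices $G_k[a]$ of size $r_{k-1}\times r_k$, $r_0=r_N=1$ and $r_k\le\chi$ for $1\le k\le N-1$. Let $\mathcal{H}=\mathcal{H}_{\mathrm{TT}}(\Lambda,\chi)$ be the set of the functions $h_A:\mathcal{B}\to\mathbb{R}$, $h_A(x)=\langle A,\Phi((x-x_0)/r)\rangle$, where $A$ ranges over the tensors of TT-rank at most $\chi$ with Frobenius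 norm $\|A\|_F\le\Lambda$. *Bounded local regression model.* $(X_1,Y_1),\dots,(X_n,Y_n)$ are i.i.d. with values in $\mathcal{B}\times\mathbb{R}$, and $Y_i=g(X_i)+\varepsilon_i$, where $g:\mathcal{B}\to\mathbb{R}$ is measurable with $|g|\le G_{\max}$ on $\mathcal{B}$, $\mathbb{E}[\varepsilon_i\mid X_i]=0$ and $|\varepsilon_i|\le\sigma$ almost surely. Put $Y_{\max}=G_{\max}+\sigma$. With $(X,Y)$ distributed as $(X_1,Y_1)$, let $$L(h)=\mathbb{E}[(h(X)-Y)^2],\qquad R(h)=\mathbb{E}[(h(X)-g(X))^2],\qquad \hat L_n(h)=\frac1n\sum_{i=1}^n (h(X_i)-Y_i)^2 .$$ An empirical risk minimizer (ERM) over $\mathcal{H}$ is a (sample-dependent) $\hat h\in\mathcal{H}$ with $\hat L_n(\hat h)\le\hat L_n(h)$ for all $h\in\mathcal{H}$. *Constants.* Let $M=(\Lambda K^N+Y_{\max})^2$ with $K=\bigl(\sum_{k\ge0}1/(k!)^2\bigr)^{1/2}$. Let $d$ be the pseudo-dimension of the squared-loss class $\mathcal{G}=\{(x,y)\mapsto(h(x)-y)^2: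 h\in\mathcal{H}\}$ of functions on $\mathcal{B}\times\mathbb{R}$, that is, the VC dimension of the class of the sets $\{(x,y,t): f(x,y)>t\}$, $f\in\mathcal{G}$. **Theorem (ERM excess-risk bound).** Assume that $d\le n$, and let $\hat h$ be an ERM over $\mathcal{H}$. Then, with probability at least $1-\delta$, $$L(\hat h)\le\inf_{h\in\mathcal{H}}L(h)+2M\sqrt{\frac{2d\log(en/d)}{n}}+2M\sqrt{\frac{\log(1/\delta)}{2n}}$$ and $$R(\hat h)\le\inf_{h\in\mathcal{H}}R(h)+2M\sqrt{\frac{2d\log(en/d)}{n}}+2M\sqrt{\frac{\log(1/\delta)}{2n}},$$ where $d\log(en/d)$ is read as $0$ if $d=0$. -/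

import Mathlib

open MeasureTheory ProbabilityTheory
open scoped Nat ENNReal

noncomputable section

namespace LocalTT

/-- The patch `B(x₀, r) = {x ∈ ℝ^N : ‖x - x₀‖_∞ ≤ r}` (the norm of `Fin N → ℝ` is the sup norm). -/
def patch {N : ℕ} (x₀ : Fin N → ℝ) (r : ℝ) : Set (Fin N → ℝ) :=
  {x | ‖x - x₀‖ ≤ r}

/-- The normalized coordinate `ξ = (x - x₀) / r`. -/
def normCoord {N : ℕ} (x₀ : Fin N → ℝ) (r : ℝ) (x : Fin N → ℝ) : Fin N → ℝ :=
  fun i => (x i - x₀ i) / r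

/-- Real tensors of order `N` with all modes of size `p + 1`. The inner product and the norm of
this space are the Frobenius inner product and the Frobenius norm. -/
abbrev Tensor (N p : ℕ) : Type := EuclideanSpace ℝ (Fin N → Fin (p + 1))

/-- The factorial feature map `Φ(ξ)[α] = ∏ i, ξ_i ^ α_i / α_i !`. -/
def featureMap (N p : ℕ) (ξ : Fin N → ℝ) : Tensor N p :=
  WithLp.toLp 2 fun α => ∏ i, ξ i ^ (α i : ℕ) / ((α i : ℕ)! : ℝ)

/-- `A` has TT-rank at most `χ`: there are ranks `ρ 0, …, ρ N` with `ρ 0 = ρ N = 1` and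
`ρ k ≤ χ` for `0 < k < N`, and cores `G k a`, which are `ρ k × ρ (k + 1)` matrices, such that
`A[α] = G 0 (α 0) * G 1 (α 1) * ⋯ * G (N - 1) (α (N - 1))`. The product of the matrices is written
entrywise, as a sum over all the paths of bond indices `j`; as `ρ 0 = ρ N = 1`, it is a scalar. -/
def TTRankLE {N p : ℕ} (χ : ℕ) (A : Tensor N p) : Prop :=
  ∃ (ρ : Fin (N + 1) → ℕ)
    (G : ∀ k : Fin N, Fin (p + 1) → Matrix (Fin (ρ k.castSucc)) (Fin (ρ k.succ)) ℝ),
    ρ 0 = 1 ∧ ρ (Fin.last N) = 1 ∧ (∀ k, k ≠ 0 → k ≠ Fin.last N → ρ k ≤ χ) ∧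
    ∀ α : Fin N → Fin (p + 1),
      A α = ∑ j : (∀ k : Fin (N + 1), Fin (ρ k)), ∏ k : Fin N, G k (α k) (j k.castSucc) (j k.succ)

/-- The constrained tensor class `A_TT(Λ, χ)`. -/
def tensorClass (N p : ℕ) (Λ : ℝ) (χ : ℕ) : Set (Tensor N p) :=
  {A | TTRankLE χ A ∧ ‖A‖ ≤ Λ}

/-- The predictor `h_A(x) = ⟨A, Φ((x - x₀) / r)⟩` on the patch. -/
def predictor {N p : ℕ} (x₀ : Fin N → ℝ) (r : ℝ) (A : Tensor N p) : patch x₀ r → ℝ :=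
  fun x => inner ℝ A (featureMap N p (normCoord x₀ r x))

/-- The hypothesis class `H_TT(Λ, χ)`. -/
def hypothesisClass {N : ℕ} (p : ℕ) (x₀ : Fin N → ℝ) (r Λ : ℝ) (χ : ℕ) :
    Set (patch x₀ r → ℝ) :=
  predictor x₀ r '' tensorClass N p Λ χ

/-- `K = √(I₀(2))`, where `I₀(2) = ∑ k, 1 / (k!)²`. -/
def besselK : ℝ := Real.sqrt (∑' k : ℕ, 1 / ((k ! : ℝ)) ^ 2)

/-- The squared-loss class `{(x, y) ↦ (h x - y)² : h ∈ H}`. -/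
def squaredLossClass {𝒳 : Type*} (H : Set (𝒳 → ℝ)) : Set (𝒳 × ℝ → ℝ) :=
  (fun h z => (h z.1 - z.2) ^ 2) '' H

/-- The finite set `S` of pairs (point, threshold) is shattered by the class of the sets
`{(z, t) : f z > t}`, `f ∈ F`. -/
def PseudoShatters {Z : Type*} (F : Set (Z → ℝ)) (S : Finset (Z × ℝ)) : Prop :=
  ∀ T ⊆ S, ∃ f ∈ F, ∀ q ∈ S, q ∈ T ↔ q.2 < f q.1

/-- The pseudo-dimension of `F`: the VC dimension of the class of the sets `{(z, t) : f z > t}`,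
`f ∈ F`, that is, the supremum of the cardinalities of the finite sets it shatters. -/
def pseudoDim {Z : Type*} (F : Set (Z → ℝ)) : ℕ∞ :=
  ⨆ (S : Finset (Z × ℝ)) (_ : PseudoShatters F S), (S.card : ℕ∞)

/-- The bounded local regression model with `n` samples on the patch. The sample is
`(X i, Y i)`, `i : Fin n`, the noise is `ε i`, and `P` is the common law of the pairs `(X i, Y i)`,
so that `P.fst` is the input distribution `P_X`. -/
structure IsLocalRegressionModel {N n : ℕ} {x₀ : Fin N → ℝ} {r : ℝ}
    {Ω : Type*} [MeasurableSpace Ω] (μ : Measure Ω)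
    (X : Fin n → Ω → patch x₀ r) (Y ε : Fin n → Ω → ℝ)
    (P : Measure (patch x₀ r × ℝ)) (g : patch x₀ r → ℝ) (Gmax σ : ℝ) : Prop where
  measurable_input : ∀ i, Measurable (X i)
  measurable_label : ∀ i, Measurable (Y i)
  measurable_noise : ∀ i, Measurable (ε i)
  measurable_target : Measurable g
  indep : iIndepFun (fun i ω => (X i ω, Y i ω)) μ
  law : ∀ i, μ.map (fun ω => (X i ω, Y i ω)) = P
  label_eq : ∀ i, ∀ᵐ ω ∂μ, Y i ω = g (X i ω) + ε i ω
  noise_unbiased : ∀ i, μ[ε i | MeasurableSpace.comap (X i) inferInstance] =ᵐ[μ] 0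
  target_bounded : ∀ x, |g x| ≤ Gmax
  noise_bounded : ∀ i, ∀ᵐ ω ∂μ, |ε i ω| ≤ σ

/-- The population risk `L(h) = E[(h(X) - Y)²]`, where `(X, Y) ∼ P`. -/
def populationRisk {𝒳 : Type*} [MeasurableSpace 𝒳] (P : Measure (𝒳 × ℝ)) (h : 𝒳 → ℝ) : ℝ :=
  ∫ z, (h z.1 - z.2) ^ 2 ∂P

/-- The clean risk `R(h) = E[(h(X) - g(X))²]`, where `X` has law `P_X`, the first marginal
of `P`. -/
def cleanRisk {𝒳 : Type*} [MeasurableSpace 𝒳] (P : Measure (𝒳 × ℝ)) (g h : 𝒳 → ℝ) : ℝ :=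
  ∫ x, (h x - g x) ^ 2 ∂P.fst

/-- The empirical risk of `h` on the sample `(x i, y i)`, `i : Fin n`. -/
def empiricalRisk {𝒳 : Type*} {n : ℕ} (x : Fin n → 𝒳) (y : Fin n → ℝ) (h : 𝒳 → ℝ) : ℝ :=
  1 / (n : ℝ) * ∑ i, (h (x i) - y i) ^ 2

/-- `h` minimizes the empirical risk on the sample `(x i, y i)` over the class `H`. -/
def IsERM {𝒳 : Type*} {n : ℕ} (H : Set (𝒳 → ℝ)) (x : Fin n → 𝒳) (y : Fin n → ℝ)
    (h : 𝒳 → ℝ) : Prop :=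
  h ∈ H ∧ ∀ h' ∈ H, empiricalRisk x y h ≤ empiricalRisk x y h'

/-- The excess-risk bound `2M √(2 d log(en/d) / n) + 2M √(log(1/δ) / (2n))`. -/
def excessBound (M : ℝ) (d n : ℕ) (δ : ℝ) : ℝ :=
  2 * M * Real.sqrt (2 * d * Real.log (Real.exp 1 * n / d) / n)
    + 2 * M * Real.sqrt (Real.log (1 / δ) / (2 * n))

end LocalTT

end

/-!
Fix two predictors `h, h'` of the class and let `D h` be the population risk of `h` minus its
empirical risk. If `h` minimizes the empirical risk, then `L h - L h' ≤ D h - D h'`, so everything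
follows from a bound of `W = sup (D h - D h')` over all pairs.

* *Concentration.* The losses take values in `[0, M]`, so a change of one sample point moves `W` by
  at most `2M / n`. McDiarmid's inequality (`measureReal_pi_ge_le_of_bounded_differences`) gives the
  term `2M √(log (1/δ) / (2n))`; working with pairs avoids a union bound over two tails.
* *Expectation.* Symmetrization (`integral_iSup_deviation_le`) bounds `E W` by a Rademacher average
  of loss differences, hence by four times the Rademacher average of the losses, divided by `n`. The
  layer-cake formula `f = ∫ 1_{f > t} dt` is applied to the Rademacher average on a fixed sample
  (`rademacherAvg_le_integral`), so that the superlevel sets are taken at one common level `t` at a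
  time; only then is their VC dimension at most the pseudo-dimension `d`
  (`vcDim_levelTraces_le`). The Sauer–Shelah lemma counts their traces on the sample by
  `(en/d) ^ d`, and Massart's lemma (`rademacherAvg_le_of_card`), applied to indicators centred at
  `1/2`, gives `E W ≤ 2M √(2 d log (en/d) / n)`.

Suprema of finitely many measurable functions are measurable, so the bound is proved for finite
families, passes to a sequence by monotone union (`measure_pi_exists_deviation_sub_gt_le`), and to
all the tensors by continuity of both risks in the tensor along a dense sequence. The losses are
bounded by `M = (Λ K ^ N + Gmax + σ) ^ 2` because the feature map has norm at most `K ^ N`, and only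
almost surely because the noise is, so they are clipped at `M`. Since the noise has conditional
mean zero, the population risk and the clean risk differ by a constant
(`IsLocalRegressionModel.populationRisk_eq`), so that the excess risks agree.
-/

namespace LocalTT

/-! ### McDiarmid's inequality -/

/-- The moment generating function of a function with bounded differences, by conditioning on the
first coordinate and applying Hoeffding's lemma to the conditional mean. -/
theorem integral_exp_pi_le_of_bounded_differences {Z : Type*} [MeasurableSpace Z]
    (P : Measure Z) [IsProbabilityMeasure P] {c : ℝ} (hc : 0 ≤ c) (t : ℝ) (n : ℕ)
    (f : (Fin n → Z) → ℝ) (hf : Measurable f) (C : ℝ) (hC : ∀ z, |f z| ≤ C)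
    (hdiff : ∀ i z w, |f (Function.update z i w) - f z| ≤ c) :
    ∫ z, Real.exp (t * (f z - ∫ z', f z' ∂Measure.pi fun _ => P)) ∂(Measure.pi fun _ => P)
      ≤ Real.exp (n * (c / 2) ^ 2 * t ^ 2 / 2) := by
  induction n with
  | zero =>
    have h0 : ∀ z, f z = f default := fun z => by rw [Subsingleton.elim z default]
    simp [h0]
  | succ n ih =>
    have : Nonempty Z := nonempty_of_isProbabilityMeasure P
    set Q : Measure (Fin n → Z) := Measure.pi fun _ => P with hQ
    have hmp := (measurePreserving_piFinSuccAbove (fun _ : Fin (n + 1) => P) 0).symm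
    have hsymm : ⇑(MeasurableEquiv.piFinSuccAbove (fun _ : Fin (n + 1) => Z) 0).symm
        = fun q : Z × (Fin n → Z) => (Fin.cons q.1 q.2 : Fin (n + 1) → Z) := by
      funext q
      exact Fin.insertNth_zero' q.1 q.2
    have hint : ∀ F : (Fin (n + 1) → Z) → ℝ, ∫ z, F z ∂(Measure.pi fun _ => P)
        = ∫ q, F (Fin.cons q.1 q.2) ∂(P.prod Q) := by
      intro F
      rw [← hmp.integral_comp', hsymm]
    have hcons : Measurable fun q : Z × (Fin n → Z) => (Fin.cons q.1 q.2 : Fin (n + 1) → Z) :=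
      hsymm ▸ hmp.measurable
    have hfc : Measurable fun q : Z × (Fin n → Z) => f (Fin.cons q.1 q.2) := hf.comp hcons
    have hbdd : ∀ {α : Type _} [MeasurableSpace α] (ν : Measure α) [IsFiniteMeasure ν]
        (F : α → ℝ) (D : ℝ), Measurable F → (∀ x, |F x| ≤ D) → Integrable F ν :=
      fun ν _ F D hF hD => .of_bound hF.aestronglyMeasurable D (ae_of_all _ hD)
    set g : Z → ℝ := fun x => ∫ y, f (Fin.cons x y) ∂Q with hg
    have hfi : Integrable (fun q : Z × (Fin n → Z) => f (Fin.cons q.1 q.2)) (P.prod Q) :=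
      hbdd _ _ C hfc fun _ => hC _
    have hfx : ∀ x, Measurable fun y : Fin n → Z => f (Fin.cons x y) := fun x =>
      hfc.comp measurable_prodMk_left
    have hfxi : ∀ x, Integrable (fun y : Fin n → Z => f (Fin.cons x y)) Q := fun x =>
      hbdd _ _ C (hfx x) fun _ => hC _
    have hgm : Measurable g := (hfc.stronglyMeasurable.integral_prod_right').measurable
    have hE : ∫ z, f z ∂(Measure.pi fun _ => P) = ∫ x, g x ∂P := by
      rw [hint, integral_prod _ hfi]
    have hgC : ∀ x, |g x| ≤ C := fun x => by
      have := norm_integral_le_of_norm_le_const (μ := Q) (C := C)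
        (f := fun y => f (Fin.cons x y)) (ae_of_all _ fun y => hC _)
      simpa using this
    have hgdiff : ∀ x x', g x - g x' ≤ c := by
      intro x x'
      rw [hg, ← integral_sub (hfxi x) (hfxi x')]
      have : ∫ y, (f (Fin.cons x y) - f (Fin.cons x' y)) ∂Q ≤ ∫ _, c ∂Q := by
        refine integral_mono ((hfxi x).sub (hfxi x')) (integrable_const _) fun y => ?_
        have := hdiff 0 (Fin.cons x' y) x
        rw [Fin.update_cons_zero] at this
        exact (le_abs_self _).trans this
      simpa using this
    -- the range of `g` lies in an interval of length `c`
    have hIcc : ∀ x, g x ∈ Set.Icc (⨅ x, g x) ((⨅ x, g x) + c) := by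
      have hbb : BddBelow (Set.range g) := ⟨-C, by rintro _ ⟨x, rfl⟩; exact (abs_le.1 (hgC x)).1⟩
      intro x
      refine ⟨ciInf_le hbb x, ?_⟩
      rw [← sub_le_iff_le_add]
      exact le_ciInf fun x' => by linarith [hgdiff x x']
    have hgsub := (hasSubgaussianMGF_of_mem_Icc hgm.aemeasurable (ae_of_all P hIcc)).mgf_le t
    have hcn : ((‖(⨅ x, g x) + c - ⨅ x, g x‖₊ / 2 : NNReal) : ℝ) = c / 2 := by
      simp [abs_of_nonneg hc]
    simp only [NNReal.coe_pow, hcn, mgf] at hgsub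
    -- the induction hypothesis bounds the fluctuation around `g` in the last `n` coordinates
    have hin : ∀ x, ∫ y, Real.exp (t * (f (Fin.cons x y) - g x)) ∂Q
        ≤ Real.exp (n * (c / 2) ^ 2 * t ^ 2 / 2) := fun x =>
      ih (fun y => f (Fin.cons x y)) (hfx x) (fun _ => hC _) fun i y w => by
        rw [Fin.cons_update]; exact hdiff _ _ _
    have hexp : ∀ a b, |a| ≤ C → |b| ≤ C → |Real.exp (t * (a - b))| ≤ Real.exp (|t| * (C + C)) := by
      intro a b ha hb
      rw [Real.abs_exp, Real.exp_le_exp]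
      calc t * (a - b) ≤ |t * (a - b)| := le_abs_self _
        _ = |t| * |a - b| := abs_mul _ _
        _ ≤ |t| * (C + C) := by gcongr; exact (abs_sub a b).trans (add_le_add ha hb)
    rw [hE, hint]
    set m := ∫ x, g x ∂P with hm
    have hmC : |m| ≤ C := by
      have := norm_integral_le_of_norm_le_const (μ := P) (f := g) (C := C) (ae_of_all _ hgC)
      simpa using this
    have hi1 : Integrable (fun q : Z × (Fin n → Z) => Real.exp (t * (f (Fin.cons q.1 q.2) - m)))
        (P.prod Q) :=
      hbdd _ _ _ (by fun_prop) fun q => hexp _ _ (hC _) hmC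
    have hi2 : Integrable (fun x => Real.exp (t * (g x - m))) P :=
      hbdd _ _ _ (by fun_prop) fun q => hexp _ _ (hgC _) hmC
    rw [integral_prod _ hi1]
    calc ∫ x, ∫ y, Real.exp (t * (f (Fin.cons x y) - m)) ∂Q ∂P
        ≤ ∫ x, Real.exp (n * (c / 2) ^ 2 * t ^ 2 / 2) * Real.exp (t * (g x - m)) ∂P := by
          refine integral_mono hi1.integral_prod_left (hi2.const_mul _) fun x => ?_
          have : ∀ y, Real.exp (t * (f (Fin.cons x y) - m))
              = Real.exp (t * (f (Fin.cons x y) - g x)) * Real.exp (t * (g x - m)) := fun y => by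
            rw [← Real.exp_add]; ring_nf
          simp only [this]
          rw [integral_mul_const]
          gcongr
          exact hin x
      _ = Real.exp (n * (c / 2) ^ 2 * t ^ 2 / 2) * ∫ x, Real.exp (t * (g x - m)) ∂P :=
          integral_const_mul _ _
      _ ≤ Real.exp (n * (c / 2) ^ 2 * t ^ 2 / 2) * Real.exp ((c / 2) ^ 2 * t ^ 2 / 2) := by
          gcongr
      _ = Real.exp ((n + 1 : ℕ) * (c / 2) ^ 2 * t ^ 2 / 2) := by
          rw [← Real.exp_add]; push_cast; ring_nf

/-- **McDiarmid's bounded differences inequality** for i.i.d. coordinates. -/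
theorem measureReal_pi_ge_le_of_bounded_differences {Z : Type*} [MeasurableSpace Z]
    (P : Measure Z) [IsProbabilityMeasure P] {c : ℝ} (hc : 0 ≤ c) {n : ℕ}
    (f : (Fin n → Z) → ℝ) (hf : Measurable f) (C : ℝ) (hC : ∀ z, |f z| ≤ C)
    (hdiff : ∀ i z w, |f (Function.update z i w) - f z| ≤ c) {s : ℝ} (hs : 0 ≤ s) :
    (Measure.pi fun _ => P).real {z | s ≤ f z - ∫ z', f z' ∂Measure.pi fun _ => P}
      ≤ Real.exp (-s ^ 2 / (2 * (n * (c / 2) ^ 2))) := by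
  set m := ∫ z', f z' ∂Measure.pi fun _ => P with hm
  have hsub : HasSubgaussianMGF (fun z => f z - m) ⟨n * (c / 2) ^ 2, by positivity⟩
      (Measure.pi fun _ : Fin n => P) := by
    refine ⟨fun t => ?_, fun t => integral_exp_pi_le_of_bounded_differences P hc t n f hf C hC hdiff⟩
    refine .of_bound (by fun_prop) (Real.exp (|t| * (C + |m|))) (ae_of_all _ fun z => ?_)
    rw [Real.norm_eq_abs, Real.abs_exp, Real.exp_le_exp]
    calc t * (f z - m) ≤ |t * (f z - m)| := le_abs_self _
      _ = |t| * |f z - m| := abs_mul _ _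
      _ ≤ |t| * (C + |m|) := by
        gcongr; exact (abs_sub _ _).trans (by gcongr; exact hC z)
  exact hsub.measure_ge_le hs

/-! ### Traces of superlevel sets and the Sauer–Shelah bound -/

theorem sum_choose_le_pow {n d : ℕ} (hdn : d ≤ n) :
    ((∑ k ∈ Finset.Iic d, n.choose k : ℕ) : ℝ) ≤ (Real.exp 1 * n / d) ^ d := by
  rcases Nat.eq_zero_or_pos d with rfl | hd
  · simp [show Finset.Iic (0 : ℕ) = {0} from rfl]
  have hd' : (0 : ℝ) < d := by exact_mod_cast hd
  have hn' : (0 : ℝ) < n := by exact_mod_cast hd.trans_le hdn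
  have hle1 : (d : ℝ) / n ≤ 1 := by rw [div_le_one hn']; exact_mod_cast hdn
  have h0 : (0 : ℝ) < d / n := by positivity
  -- weigh the binomial coefficients with `(d / n) ^ k ≥ (d / n) ^ d`
  have key : ((∑ k ∈ Finset.Iic d, n.choose k : ℕ) : ℝ) * ((d : ℝ) / n) ^ d ≤ Real.exp 1 ^ d := by
    calc ((∑ k ∈ Finset.Iic d, n.choose k : ℕ) : ℝ) * ((d : ℝ) / n) ^ d
        = ∑ k ∈ Finset.Iic d, (n.choose k : ℝ) * ((d : ℝ) / n) ^ d := by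
          push_cast; rw [Finset.sum_mul]
      _ ≤ ∑ k ∈ Finset.Iic d, (n.choose k : ℝ) * ((d : ℝ) / n) ^ k := by
          refine Finset.sum_le_sum fun k hk => ?_
          gcongr ?_ * ?_
          exact pow_le_pow_of_le_one h0.le hle1 (Finset.mem_Iic.1 hk)
      _ ≤ ∑ k ∈ Finset.range (n + 1), (n.choose k : ℝ) * ((d : ℝ) / n) ^ k := by
          refine Finset.sum_le_sum_of_subset_of_nonneg (fun k hk => ?_) fun _ _ _ => by positivity
          have := Finset.mem_Iic.1 hk
          exact Finset.mem_range.2 (by omega)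
      _ = ((d : ℝ) / n + 1) ^ n := by
          rw [add_pow]
          exact Finset.sum_congr rfl fun k _ => by ring
      _ ≤ Real.exp (d / n) ^ n := by
          gcongr; exact Real.add_one_le_exp _
      _ = Real.exp 1 ^ d := by
          rw [← Real.exp_nat_mul, ← Real.exp_nat_mul]; congr 1; field_simp
  have e : (Real.exp 1 * n / d) ^ d = Real.exp 1 ^ d / ((d : ℝ) / n) ^ d := by
    rw [← div_pow]; congr 1; field_simp
  rw [e, le_div_iff₀ (by positivity)]
  exact key

/-- The traces on the sample `z` of the superlevel sets `{f > t}`, `f ∈ F`, as subsets of the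
index set of the sample. -/
noncomputable def levelTraces {Z : Type*} {n : ℕ} (F : Set (Z → ℝ)) (z : Fin n → Z) (t : ℝ) :
    Finset (Finset (Fin n)) :=
  open Classical in
  Finset.univ.filter fun T => ∃ f ∈ F, ∀ k, k ∈ T ↔ t < f (z k)

theorem mem_levelTraces {Z : Type*} {n : ℕ} {F : Set (Z → ℝ)} {z : Fin n → Z} {t : ℝ}
    {T : Finset (Fin n)} : T ∈ levelTraces F z t ↔ ∃ f ∈ F, ∀ k, k ∈ T ↔ t < f (z k) := by
  simp [levelTraces]

/-- At a fixed level `t`, a set of sample indices shattered by the traces gives a set of pairs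
`(z k, t)` that is shattered in the sense of the pseudo-dimension. -/
theorem vcDim_levelTraces_le {Z : Type*} {n d : ℕ} {F : Set (Z → ℝ)}
    (hd : pseudoDim F ≤ (d : ℕ∞)) (z : Fin n → Z) (t : ℝ) : (levelTraces F z t).vcDim ≤ d := by
  classical
  refine Finset.sup_le fun S hS => ?_
  rw [Finset.mem_shatterer] at hS
  have hinj : Set.InjOn (fun k => (z k, t)) (S : Set (Fin n)) := by
    intro a ha b hb hab
    by_contra hne
    obtain ⟨u, hu, hSu⟩ := hS (Finset.singleton_subset_iff.2 ha)
    obtain ⟨f, -, hf⟩ := mem_levelTraces.1 hu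
    have ha' : a ∈ u := (Finset.mem_inter.1 (hSu ▸ Finset.mem_singleton_self a)).2
    have hb' : b ∉ u := fun h => hne <| by
      have : b ∈ S ∩ u := Finset.mem_inter.2 ⟨hb, h⟩
      rw [hSu] at this
      exact (Finset.mem_singleton.1 this).symm
    rw [hf] at ha' hb'
    rw [show z a = z b from (Prod.ext_iff.1 hab).1] at ha'
    exact hb' ha'
  have hsh : PseudoShatters F (S.image fun k => (z k, t)) := by
    intro T _
    obtain ⟨u, hu, hSu⟩ := hS (Finset.filter_subset (fun k => (z k, t) ∈ T) S)
    obtain ⟨f, hfF, hf⟩ := mem_levelTraces.1 hu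
    refine ⟨f, hfF, fun q hq => ?_⟩
    obtain ⟨k, hk, rfl⟩ := Finset.mem_image.1 hq
    rw [← hf k]
    have := congrArg (k ∈ ·) hSu
    simp only [Finset.mem_inter, Finset.mem_filter, hk, true_and, eq_iff_iff] at this
    exact this.symm
  have hle : ((S.image fun k => (z k, t)).card : ℕ∞) ≤ d :=
    (le_iSup₂ (f := fun (S : Finset (Z × ℝ)) (_ : PseudoShatters F S) => (S.card : ℕ∞)) _ hsh).trans
      hd
  rw [Finset.card_image_of_injOn hinj] at hle
  exact_mod_cast hle

theorem card_levelTraces_le {Z : Type*} {n d : ℕ} {F : Set (Z → ℝ)}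
    (hd : pseudoDim F ≤ (d : ℕ∞)) (hdn : d ≤ n) (z : Fin n → Z) (t : ℝ) :
    ((levelTraces F z t).card : ℝ) ≤ (Real.exp 1 * n / d) ^ d := by
  refine le_trans ?_ (sum_choose_le_pow hdn)
  have h1 := (levelTraces F z t).card_le_card_shatterer.trans
    (Finset.card_shatterer_le_sum_vcDim (𝒜 := levelTraces F z t))
  rw [Fintype.card_fin] at h1
  refine Nat.cast_le.2 (h1.trans ?_)
  exact Finset.sum_le_sum_of_subset (Finset.Iic_subset_Iic.2 (vcDim_levelTraces_le hd z t))

/-! ### Rademacher averages -/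

/-- The Rademacher average `E_σ sup_i ∑ k, σ k * a i k` of a family of vectors, where the signs
`σ k` are independent and uniform, as a mean over all sign patterns. It is not divided by `n`. -/
noncomputable def rademacherAvg {ι : Type*} {n : ℕ} (a : ι → Fin n → ℝ) : ℝ :=
  (2 ^ n : ℝ)⁻¹ * ∑ σ : Fin n → ℤˣ, ⨆ i, ∑ k, ((σ k : ℤ) : ℝ) * a i k

theorem card_signs (n : ℕ) : Fintype.card (Fin n → ℤˣ) = 2 ^ n := by simp

theorem sum_signs_neg {n : ℕ} (G : (Fin n → ℤˣ) → ℝ) : ∑ σ, G (-σ) = ∑ σ, G σ :=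
  Equiv.sum_comp (Equiv.neg _) G

theorem sum_signs_linear {n : ℕ} (b : Fin n → ℝ) :
    ∑ σ : Fin n → ℤˣ, ∑ k, ((σ k : ℤ) : ℝ) * b k = 0 := by
  have h := sum_signs_neg fun σ : Fin n → ℤˣ => ∑ k, ((σ k : ℤ) : ℝ) * b k
  simp only [Pi.neg_apply, Units.val_neg, Int.cast_neg, neg_mul, Finset.sum_neg_distrib] at h
  linarith

theorem sum_signs_exp_le {n : ℕ} (a : Fin n → ℝ) {B s : ℝ} (hB : ∑ k, a k ^ 2 ≤ B) :
    (2 ^ n : ℝ)⁻¹ * ∑ σ : Fin n → ℤˣ, Real.exp (s * ∑ k, ((σ k : ℤ) : ℝ) * a k)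
      ≤ Real.exp (s ^ 2 * B / 2) := by
  have h1 : ∑ σ : Fin n → ℤˣ, Real.exp (s * ∑ k, ((σ k : ℤ) : ℝ) * a k)
      = ∏ k, ∑ u : ℤˣ, Real.exp (s * (((u : ℤ) : ℝ) * a k)) := by
    rw [Finset.prod_univ_sum, Fintype.piFinset_univ]
    exact Finset.sum_congr rfl fun σ _ => by rw [Finset.mul_sum, Real.exp_sum]
  have h2 : ∀ k, ∑ u : ℤˣ, Real.exp (s * (((u : ℤ) : ℝ) * a k)) = 2 * Real.cosh (s * a k) := by
    intro k
    rw [Real.cosh_eq, show (Finset.univ : Finset ℤˣ) = {1, -1} from rfl,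
      Finset.sum_pair (by decide)]
    simp; ring
  rw [h1]
  simp only [h2]
  rw [Finset.prod_mul_distrib]
  simp only [Finset.prod_const, Finset.card_univ, Fintype.card_fin]
  rw [inv_mul_cancel_left₀ (by positivity)]
  calc ∏ k, Real.cosh (s * a k) ≤ ∏ k, Real.exp ((s * a k) ^ 2 / 2) :=
        Finset.prod_le_prod (fun k _ => (Real.cosh_pos _).le) fun k _ => Real.cosh_le_exp_half_sq _
    _ = Real.exp (∑ k, (s * a k) ^ 2 / 2) := (Real.exp_sum _ _).symm
    _ ≤ Real.exp (s ^ 2 * B / 2) := by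
        rw [Real.exp_le_exp, ← Finset.sum_div]
        simp only [mul_pow]
        rw [← Finset.mul_sum]
        gcongr

/-- **Massart's finite class lemma**: only the number of distinct vectors of the family matters. -/
theorem rademacherAvg_le_of_card {ι : Type*} [Nonempty ι] {n : ℕ} (a : ι → Fin n → ℝ)
    (V : Finset (Fin n → ℝ)) (haV : ∀ i, a i ∈ V) {B Γ : ℝ} (hB0 : 0 ≤ B)
    (hB : ∀ v ∈ V, ∑ k, v k ^ 2 ≤ B) (hΓ : (V.card : ℝ) ≤ Γ) :
    rademacherAvg a ≤ Real.sqrt (2 * B * Real.log Γ) := by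
  have hVne : V.Nonempty := ⟨_, haV (Classical.arbitrary ι)⟩
  have hΓ1 : 1 ≤ Γ := le_trans (by exact_mod_cast hVne.card_pos) hΓ
  have hlog : 0 ≤ Real.log Γ := Real.log_nonneg hΓ1
  have main : ∀ s : ℝ, 0 < s → s * rademacherAvg a ≤ Real.log Γ + s ^ 2 * B / 2 := by
    intro s hs
    set S : (Fin n → ℤˣ) → ℝ := fun σ => ⨆ i, ∑ k, ((σ k : ℤ) : ℝ) * a i k with hS
    have hJ : Real.exp (s * rademacherAvg a)
        ≤ ∑ σ : Fin n → ℤˣ, (2 ^ n : ℝ)⁻¹ * Real.exp (s * S σ) := by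
      have := convexOn_exp.map_sum_le (t := (Finset.univ : Finset (Fin n → ℤˣ)))
        (w := fun _ => (2 ^ n : ℝ)⁻¹) (p := fun σ => s * S σ) (fun _ _ => by positivity)
        (by rw [Finset.sum_const, Finset.card_univ, card_signs]; simp) fun _ _ => Set.mem_univ _
      simp only [smul_eq_mul] at this
      refine le_trans (le_of_eq ?_) this
      rw [rademacherAvg, Finset.mul_sum, Finset.mul_sum]
      congr 1
      exact Finset.sum_congr rfl fun σ _ => by rw [hS]; ring
    have hsup : ∀ σ, Real.exp (s * S σ)
        ≤ ∑ v ∈ V, Real.exp (s * ∑ k, ((σ k : ℤ) : ℝ) * v k) := by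
      intro σ
      obtain ⟨v, hvV, hv⟩ := V.exists_max_image (fun v => ∑ k, ((σ k : ℤ) : ℝ) * v k) hVne
      have h1 : S σ ≤ ∑ k, ((σ k : ℤ) : ℝ) * v k := ciSup_le fun i => hv _ (haV i)
      refine le_trans ?_ (Finset.single_le_sum
        (f := fun v : Fin n → ℝ => Real.exp (s * ∑ k, ((σ k : ℤ) : ℝ) * v k))
        (fun _ _ => (Real.exp_pos _).le) hvV)
      exact Real.exp_le_exp.2 (by gcongr)
    have hexp : Real.exp (s * rademacherAvg a) ≤ Γ * Real.exp (s ^ 2 * B / 2) := by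
      calc Real.exp (s * rademacherAvg a)
          ≤ ∑ σ : Fin n → ℤˣ, (2 ^ n : ℝ)⁻¹ *
              ∑ v ∈ V, Real.exp (s * ∑ k, ((σ k : ℤ) : ℝ) * v k) :=
            hJ.trans (Finset.sum_le_sum fun σ _ => by gcongr; exact hsup σ)
        _ = ∑ v ∈ V, (2 ^ n : ℝ)⁻¹ *
              ∑ σ : Fin n → ℤˣ, Real.exp (s * ∑ k, ((σ k : ℤ) : ℝ) * v k) := by
            rw [← Finset.mul_sum, Finset.sum_comm, Finset.mul_sum]
        _ ≤ ∑ v ∈ V, Real.exp (s ^ 2 * B / 2) :=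
            Finset.sum_le_sum fun v hv => sum_signs_exp_le v (hB v hv)
        _ ≤ Γ * Real.exp (s ^ 2 * B / 2) := by
            rw [Finset.sum_const, nsmul_eq_mul]; gcongr
    have := Real.log_le_log (Real.exp_pos _) hexp
    rwa [Real.log_exp, Real.log_mul (by positivity) (Real.exp_pos _).ne', Real.log_exp] at this
  rcases le_or_gt (rademacherAvg a) 0 with hR | hR
  · exact hR.trans (Real.sqrt_nonneg _)
  refine Real.le_sqrt_of_sq_le ?_
  rcases hB0.eq_or_lt with rfl | hB0
  · have h := main ((Real.log Γ + 1) / rademacherAvg a) (by positivity)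
    rw [div_mul_cancel₀ _ hR.ne'] at h
    linarith
  · -- the optimal parameter is `s = R / B`
    have h := main (rademacherAvg a / B) (by positivity)
    have e1 : rademacherAvg a / B * rademacherAvg a = rademacherAvg a ^ 2 / B := by ring
    have e2 : (rademacherAvg a / B) ^ 2 * B / 2 = rademacherAvg a ^ 2 / B / 2 := by field_simp
    rw [e1, e2] at h
    have h' : rademacherAvg a ^ 2 / B ≤ 2 * Real.log Γ := by linarith
    rw [div_le_iff₀ hB0] at h'
    linarith

theorem bddAbove_range_of_finite {ι : Type*} [Finite ι] (f : ι → ℝ) : BddAbove (Set.range f) :=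
  (Set.finite_range f).bddAbove

theorem rademacherAvg_nonneg {ι : Type*} [Finite ι] [Nonempty ι] {n : ℕ} (a : ι → Fin n → ℝ) :
    0 ≤ rademacherAvg a := by
  have i₀ : ι := Classical.arbitrary ι
  refine mul_nonneg (by positivity) ?_
  rw [← sum_signs_linear (a i₀)]
  exact Finset.sum_le_sum fun σ _ => le_ciSup
    (f := fun i => ∑ k, ((σ k : ℤ) : ℝ) * a i k) (bddAbove_range_of_finite _) i₀

theorem rademacherAvg_sub_right {ι : Type*} [Finite ι] [Nonempty ι] {n : ℕ} (a : ι → Fin n → ℝ)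
    (b : Fin n → ℝ) : rademacherAvg (fun i k => a i k - b k) = rademacherAvg a := by
  have h : ∀ σ : Fin n → ℤˣ, ⨆ i, ∑ k, ((σ k : ℤ) : ℝ) * (a i k - b k)
      = (⨆ i, ∑ k, ((σ k : ℤ) : ℝ) * a i k) - ∑ k, ((σ k : ℤ) : ℝ) * b k := by
    intro σ
    simp only [mul_sub, Finset.sum_sub_distrib]
    exact (ciSup_sub (bddAbove_range_of_finite _) _).symm
  rw [rademacherAvg, rademacherAvg, Finset.sum_congr rfl fun σ _ => h σ, Finset.sum_sub_distrib,
    sum_signs_linear, sub_zero]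

theorem rademacherAvg_comp_le {ι κ : Type*} [Finite ι] [Nonempty κ] {n : ℕ} (a : ι → Fin n → ℝ)
    (e : κ → ι) : rademacherAvg (fun j => a (e j)) ≤ rademacherAvg a := by
  rw [rademacherAvg, rademacherAvg]
  gcongr with σ
  exact ciSup_le fun j => le_ciSup (f := fun i => ∑ k, ((σ k : ℤ) : ℝ) * a i k)
    (bddAbove_range_of_finite _) (e j)

/-- Differences cost only a sum, because the distribution of the signs is symmetric. -/
theorem rademacherAvg_sub_le {ι : Type*} [Finite ι] [Nonempty ι] {n : ℕ} (a b : ι → Fin n → ℝ) :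
    rademacherAvg (fun i k => a i k - b i k) ≤ rademacherAvg a + rademacherAvg b := by
  set S : (ι → Fin n → ℝ) → (Fin n → ℤˣ) → ℝ :=
    fun a σ => ⨆ i, ∑ k, ((σ k : ℤ) : ℝ) * a i k with hS
  have hle : ∀ (a : ι → Fin n → ℝ) σ i, ∑ k, ((σ k : ℤ) : ℝ) * a i k ≤ S a σ := fun a σ i =>
    le_ciSup (f := fun i => ∑ k, ((σ k : ℤ) : ℝ) * a i k) (bddAbove_range_of_finite _) i
  have h : ∀ σ : Fin n → ℤˣ,
      ⨆ i, ∑ k, ((σ k : ℤ) : ℝ) * (a i k - b i k) ≤ S a σ + S b (-σ) := by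
    intro σ
    refine ciSup_le fun i => ?_
    have h1 := hle a σ i
    have h2 := hle b (-σ) i
    simp only [Pi.neg_apply, Units.val_neg, Int.cast_neg, neg_mul, Finset.sum_neg_distrib] at h2
    simp only [mul_sub, Finset.sum_sub_distrib]
    linarith
  calc rademacherAvg (fun i k => a i k - b i k)
      ≤ (2 ^ n : ℝ)⁻¹ * ∑ σ : Fin n → ℤˣ, (S a σ + S b (-σ)) := by
        rw [rademacherAvg]; gcongr; exact h _
    _ = rademacherAvg a + rademacherAvg b := by
        rw [Finset.sum_add_distrib, sum_signs_neg, rademacherAvg, rademacherAvg, mul_add]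

/-- The layer-cake formula for a number in `[0, M]`. -/
theorem integral_indicator_lt {x M : ℝ} (h0 : 0 ≤ x) (hM : x ≤ M) :
    ∫ t in Set.Ico 0 M, (if t < x then (1 : ℝ) else 0) = x := by
  have : ∀ t, (if t < x then (1 : ℝ) else 0) = (Set.Iio x).indicator (fun _ => 1) t := fun t => by
    simp [Set.indicator]
  simp only [this]
  rw [integral_indicator measurableSet_Iio, setIntegral_const, smul_eq_mul, mul_one,
    measureReal_restrict_apply measurableSet_Iio]
  rw [show Set.Iio x ∩ Set.Ico 0 M = Set.Ico 0 x by ext t; simp; constructor <;> intro h <;> grind]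
  simp [h0]

theorem rademacherAvg_le_integral {ι : Type*} [Finite ι] [Nonempty ι] {n : ℕ}
    (a : ι → Fin n → ℝ) {M : ℝ} (h0 : ∀ i k, 0 ≤ a i k) (hM : ∀ i k, a i k ≤ M) :
    rademacherAvg a
      ≤ ∫ t in Set.Ico 0 M, rademacherAvg fun i k => if t < a i k then (1 : ℝ) else 0 := by
  have hmeas : ∀ i k, Measurable fun t : ℝ => if t < a i k then (1 : ℝ) else 0 := fun i k =>
    Measurable.ite measurableSet_Iio measurable_const measurable_const
  have hi1 : ∀ i k, IntegrableOn (fun t : ℝ => if t < a i k then (1 : ℝ) else 0) (Set.Ico 0 M) :=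
    fun i k => Integrable.of_bound (hmeas i k).aestronglyMeasurable 1
      (ae_of_all _ fun t => by split_ifs <;> simp)
  have hi2 : ∀ (σ : Fin n → ℤˣ) i, IntegrableOn
      (fun t : ℝ => ∑ k, ((σ k : ℤ) : ℝ) * if t < a i k then (1 : ℝ) else 0) (Set.Ico 0 M) :=
    fun σ i => integrable_finsetSum _ fun k _ => (hi1 i k).const_mul _
  have hbd : ∀ (σ : Fin n → ℤˣ) i (t : ℝ),
      |∑ k, ((σ k : ℤ) : ℝ) * if t < a i k then (1 : ℝ) else 0| ≤ n := by
    intro σ i t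
    refine (Finset.abs_sum_le_sum_abs _ _).trans ?_
    refine (Finset.sum_le_card_nsmul _ _ 1 fun k _ => ?_).trans (by simp)
    rcases Int.units_eq_one_or (σ k) with h | h <;> rw [h] <;> split_ifs <;> simp
  have hi3 : ∀ σ : Fin n → ℤˣ, IntegrableOn
      (fun t : ℝ => ⨆ i, ∑ k, ((σ k : ℤ) : ℝ) * if t < a i k then (1 : ℝ) else 0)
      (Set.Ico 0 M) := by
    intro σ
    refine Integrable.of_bound (C := n) (Measurable.aestronglyMeasurable ?_) (ae_of_all _ fun t => ?_)
    · exact Measurable.iSup fun i => Finset.measurable_sum _ fun k _ => (hmeas i k).const_mul _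
    · rw [Real.norm_eq_abs, abs_le]
      refine ⟨?_, ciSup_le fun i => (abs_le.1 (hbd σ i t)).2⟩
      exact (abs_le.1 (hbd σ (Classical.arbitrary ι) t)).1.trans
        (le_ciSup (f := fun i => ∑ k, ((σ k : ℤ) : ℝ) * if t < a i k then (1 : ℝ) else 0)
          (bddAbove_range_of_finite _) _)
  simp only [rademacherAvg]
  rw [integral_const_mul, integral_finsetSum _ fun σ _ => hi3 σ]
  gcongr with σ _
  refine ciSup_le fun i => ?_
  calc ∑ k, ((σ k : ℤ) : ℝ) * a i k
      = ∫ t in Set.Ico 0 M, ∑ k, ((σ k : ℤ) : ℝ) * if t < a i k then (1 : ℝ) else 0 := by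
        rw [integral_finsetSum _ fun k _ => (hi1 i k).const_mul _]
        refine Finset.sum_congr rfl fun k _ => ?_
        rw [integral_const_mul, integral_indicator_lt (h0 i k) (hM i k)]
    _ ≤ _ := by
        refine integral_mono (hi2 σ i) (hi3 σ) fun t => ?_
        exact le_ciSup (f := fun i => ∑ k, ((σ k : ℤ) : ℝ) * if t < a i k then (1 : ℝ) else 0)
          (bddAbove_range_of_finite _) i

/-- Bound of the Rademacher average of a family of vectors in `[0, M] ^ n` by the number `Γ` of
subsets of the index set that its superlevel sets can cut out at a common level. -/
theorem rademacherAvg_le_of_levelTraces {ι Z : Type*} [Finite ι] [Nonempty ι] {n : ℕ}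
    (f : ι → Z → ℝ) (z : Fin n → Z) {M Γ : ℝ} (hM0 : 0 ≤ M) (h0 : ∀ i x, 0 ≤ f i x)
    (hM : ∀ i x, f i x ≤ M)
    (hΓ : ∀ t, t < M → ((levelTraces (Set.range f) z t).card : ℝ) ≤ Γ) :
    rademacherAvg (fun i k => f i (z k)) ≤ M * Real.sqrt (n * Real.log Γ / 2) := by
  classical
  have hlevel : ∀ t, t < M → rademacherAvg (fun i k => if t < f i (z k) then (1 : ℝ) else 0)
      ≤ Real.sqrt (n * Real.log Γ / 2) := by
    intro t ht
    -- centring the indicators at `1 / 2` makes all the entries equal to `± 1 / 2`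
    rw [← rademacherAvg_sub_right _ fun _ => 1 / 2]
    refine (rademacherAvg_le_of_card _ ((levelTraces (Set.range f) z t).image fun T k =>
      (if k ∈ T then (1 : ℝ) else 0) - 1 / 2) (fun i => ?_) (B := n / 4) (by positivity)
      (fun v hv => ?_) ((Nat.cast_le.2 Finset.card_image_le).trans (hΓ t ht))).trans_eq ?_
    · refine Finset.mem_image.2 ⟨Finset.univ.filter fun k => t < f i (z k), ?_, by simp⟩
      exact mem_levelTraces.2 ⟨f i, ⟨i, rfl⟩, by simp⟩
    · obtain ⟨T, -, rfl⟩ := Finset.mem_image.1 hv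
      refine (Finset.sum_le_card_nsmul _ _ (1 / 4) fun k _ => ?_).trans_eq ?_
      · dsimp only
        split_ifs <;> norm_num
      · simp; ring
    · congr 1; ring
  refine (rademacherAvg_le_integral _ (fun i k => h0 i (z k)) fun i k => hM i (z k)).trans ?_
  have hle := norm_setIntegral_le_of_norm_le_const (μ := volume) (s := Set.Ico 0 M)
    (f := fun t => rademacherAvg fun i k => if t < f i (z k) then (1 : ℝ) else 0)
    (C := Real.sqrt (n * Real.log Γ / 2)) (by simp) fun t ht => by
      rw [Real.norm_of_nonneg (rademacherAvg_nonneg _)]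
      exact hlevel t ht.2
  refine (le_abs_self _).trans (hle.trans_eq ?_)
  rw [measureReal_def, Real.volume_Ico, sub_zero, ENNReal.toReal_ofReal hM0, mul_comm]

/-! ### Symmetrization -/

theorem integral_comp_measurePreserving {α β : Type*} [MeasurableSpace α] [MeasurableSpace β]
    {μ : Measure α} {ν : Measure β} {T : α → β} (hT : MeasurePreserving T μ ν) {F : β → ℝ}
    (hF : Measurable F) : ∫ x, F (T x) ∂μ = ∫ y, F y ∂ν := by
  rw [← hT.map_eq, integral_map hT.measurable.aemeasurable hF.aestronglyMeasurable]

theorem abs_ciSup_le {ι : Type*} [Finite ι] [Nonempty ι] {f : ι → ℝ} {C : ℝ}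
    (h : ∀ i, |f i| ≤ C) : |⨆ i, f i| ≤ C :=
  abs_le.2 ⟨(abs_le.1 (h (Classical.arbitrary ι))).1.trans
    (le_ciSup (bddAbove_range_of_finite f) _), ciSup_le fun i => (abs_le.1 (h i)).2⟩

theorem abs_sum_le_of_abs_le {n : ℕ} {a : Fin n → ℝ} {C : ℝ} (h : ∀ k, |a k| ≤ C) :
    |∑ k, a k| ≤ n * C :=
  (Finset.abs_sum_le_sum_abs _ _).trans
    ((Finset.sum_le_card_nsmul _ _ C fun k _ => h k).trans (by simp))

theorem abs_sign_mul {n : ℕ} (σ : Fin n → ℤˣ) (k : Fin n) (x : ℝ) :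
    |((σ k : ℤ) : ℝ) * x| = |x| := by
  rcases Int.units_eq_one_or (σ k) with h | h <;> rw [h] <;> simp

theorem measurable_rademacherAvg {ι Z : Type*} [MeasurableSpace Z] [Finite ι] {n : ℕ}
    {f : ι → Z → ℝ} (hf : ∀ j, Measurable (f j)) :
    Measurable fun z : Fin n → Z => rademacherAvg fun j k => f j (z k) := by
  unfold rademacherAvg
  exact (Finset.measurable_sum _ fun σ _ => Measurable.iSup fun j => Finset.measurable_sum _
    fun k _ => ((hf j).comp (measurable_pi_apply k)).const_mul _).const_mul _

theorem integrable_rademacherAvg {ι Z : Type*} [MeasurableSpace Z] [Finite ι] [Nonempty ι]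
    {n : ℕ} {f : ι → Z → ℝ} (hf : ∀ j, Measurable (f j)) {C : ℝ} (hC : ∀ j x, |f j x| ≤ C)
    (ν : Measure (Fin n → Z)) [IsFiniteMeasure ν] :
    Integrable (fun z => rademacherAvg fun j k => f j (z k)) ν := by
  unfold rademacherAvg
  refine (integrable_finsetSum _ fun σ _ => ?_).const_mul _
  refine .of_bound (C := n * C) (Measurable.aestronglyMeasurable ?_) (ae_of_all _ fun z => ?_)
  · exact Measurable.iSup fun j => Finset.measurable_sum _
      fun k _ => ((hf j).comp (measurable_pi_apply k)).const_mul _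
  · exact abs_ciSup_le fun j => abs_sum_le_of_abs_le fun k => by
      rw [abs_sign_mul]; exact hC _ _

/-- **Symmetrization**: the expected uniform deviation between means and sample sums is at most
twice the expected Rademacher average. -/
theorem integral_iSup_deviation_le {ι Z : Type*} [MeasurableSpace Z] [Finite ι] [Nonempty ι]
    (P : Measure Z) [IsProbabilityMeasure P] {n : ℕ} {f : ι → Z → ℝ}
    (hf : ∀ j, Measurable (f j)) {C : ℝ} (hC : ∀ j x, |f j x| ≤ C) :
    ∫ z : Fin n → Z, ⨆ j, ∑ k, (∫ x, f j x ∂P - f j (z k)) ∂(Measure.pi fun _ => P)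
      ≤ 2 * ∫ z : Fin n → Z, rademacherAvg (fun j k => f j (z k)) ∂(Measure.pi fun _ => P) := by
  set Pn : Measure (Fin n → Z) := Measure.pi fun _ => P with hPn
  set Q : Measure (Fin n → Z × Z) := Measure.pi fun _ => P.prod P with hQ
  have hfk : ∀ j k, Measurable fun z : Fin n → Z => f j (z k) := fun j k =>
    (hf j).comp (measurable_pi_apply k)
  have hEC : ∀ j, |∫ x, f j x ∂P| ≤ C := fun j => by
    simpa using norm_integral_le_of_norm_le_const (μ := P) (f := f j) (C := C)
      (ae_of_all _ fun x => hC j x)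
  -- `D σ w` is the signed deviation between the sample and the ghost sample
  set D : (Fin n → ℤˣ) → (Fin n → Z × Z) → ℝ :=
    fun σ w => ⨆ j, ∑ k, ((σ k : ℤ) : ℝ) * (f j (w k).2 - f j (w k).1) with hD
  have hDm : ∀ σ, Measurable (D σ) := fun σ =>
    Measurable.iSup fun j => Finset.measurable_sum _ fun k _ =>
      (((hf j).comp (measurable_snd.comp (measurable_pi_apply k))).sub
        ((hf j).comp (measurable_fst.comp (measurable_pi_apply k)))).const_mul _
  have hDi : ∀ σ, Integrable (D σ) Q := fun σ =>
    .of_bound (C := n * (C + C)) (hDm σ).aestronglyMeasurable (ae_of_all _ fun w =>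
      abs_ciSup_le fun j => abs_sum_le_of_abs_le fun k => by
        rw [abs_sign_mul]; exact (abs_sub _ _).trans (add_le_add (hC _ _) (hC _ _)))
  have hmp2 := measurePreserving_arrowProdEquivProdArrow Z Z (Fin n) (fun _ => P) fun _ => P
  have hghost : ∫ z, ⨆ j, ∑ k, (∫ x, f j x ∂P - f j (z k)) ∂Pn ≤ ∫ w, D 1 w ∂Q := by
    set D' : (Fin n → Z) × (Fin n → Z) → ℝ :=
      fun q => ⨆ j, ∑ k, (f j (q.2 k) - f j (q.1 k)) with hD'
    have e1 : ∫ w, D 1 w ∂Q = ∫ q, D' q ∂(Pn.prod Pn) := by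
      rw [← hmp2.integral_comp']
      refine integral_congr_ae (ae_of_all _ fun w => ?_)
      simp only [hD, hD', Pi.one_apply, Units.val_one, Int.cast_one, one_mul]
      rfl
    have hD'm : Measurable D' := Measurable.iSup fun j => Finset.measurable_sum _ fun k _ =>
      ((hfk j k).comp measurable_snd).sub ((hfk j k).comp measurable_fst)
    have hD'b : ∀ q, |D' q| ≤ n * (C + C) := fun q => abs_ciSup_le fun j =>
      abs_sum_le_of_abs_le fun k => (abs_sub _ _).trans (add_le_add (hC _ _) (hC _ _))
    have hD'i : Integrable D' (Pn.prod Pn) :=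
      .of_bound (C := n * (C + C)) hD'm.aestronglyMeasurable (ae_of_all _ hD'b)
    rw [e1, integral_prod _ hD'i]
    refine integral_mono (.of_bound (C := n * (C + C)) (Measurable.aestronglyMeasurable ?_)
      (ae_of_all _ fun z => ?_)) hD'i.integral_prod_left fun z => ?_
    · exact Measurable.iSup fun j => Finset.measurable_sum _ fun k _ => (hfk j k).const_sub _
    · exact abs_ciSup_le fun j => abs_sum_le_of_abs_le fun k =>
        (abs_sub _ _).trans (add_le_add (hEC _) (hC _ _))
    · refine ciSup_le fun j => ?_
      have hik : ∀ k, Integrable (fun z' : Fin n → Z => f j (z' k)) Pn := fun k =>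
        .of_bound (C := C) (hfk j k).aestronglyMeasurable (ae_of_all _ fun _ => hC _ _)
      have hEk : ∀ k, ∫ z', f j (z' k) ∂Pn = ∫ x, f j x ∂P := fun k =>
        integral_comp_measurePreserving (measurePreserving_eval (fun _ : Fin n => P) k) (hf j)
      calc ∑ k, (∫ x, f j x ∂P - f j (z k))
          = ∫ z', ∑ k, (f j (z' k) - f j (z k)) ∂Pn := by
            rw [integral_finsetSum _ fun k _ => by exact (hik k).sub (integrable_const _)]
            refine Finset.sum_congr rfl fun k _ => ?_
            rw [integral_sub (hik k) (integrable_const _), hEk]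
            simp
        _ ≤ ∫ z', D' (z, z') ∂Pn := by
            refine integral_mono (integrable_finsetSum _ fun k _ =>
              (hik k).sub (integrable_const _)) ?_ fun z' => ?_
            · exact .of_bound (C := n * (C + C))
                (hD'm.comp measurable_prodMk_left).aestronglyMeasurable (ae_of_all _ fun _ => hD'b _)
            · exact le_ciSup (f := fun j => ∑ k, (f j (z' k) - f j (z k)))
                (bddAbove_range_of_finite _) j
  -- exchanging a point with its ghost does not change the law of the double sample
  have hswap : ∀ σ, ∫ w, D σ w ∂Q = ∫ w, D 1 w ∂Q := by
    intro σ
    let T : (Fin n → Z × Z) → (Fin n → Z × Z) :=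
      fun w k => if σ k = 1 then w k else (w k).swap
    have hT : MeasurePreserving T Q Q := by
      refine measurePreserving_pi (fun _ => P.prod P) (fun _ => P.prod P)
        (f := fun k q => if σ k = 1 then q else q.swap) fun k => ?_
      by_cases h : σ k = 1
      · simp only [h, if_true]; exact MeasurePreserving.id (P.prod P)
      · simpa [h] using Measure.measurePreserving_swap (μ := P) (ν := P)
    rw [← integral_comp_measurePreserving hT (hDm 1)]
    refine integral_congr_ae (ae_of_all _ fun w => ?_)
    simp only [hD]
    congr! 3 with j k
    rcases Int.units_eq_one_or (σ k) with h | h <;> simp [T, h]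
  have hm1 : MeasurePreserving (fun (w : Fin n → Z × Z) k => (w k).1) Q Pn :=
    measurePreserving_pi _ _ fun _ => measurePreserving_fst
  have hm2 : MeasurePreserving (fun (w : Fin n → Z × Z) k => (w k).2) Q Pn :=
    measurePreserving_pi _ _ fun _ => measurePreserving_snd
  have hRm := measurable_rademacherAvg (n := n) hf
  have hRi := integrable_rademacherAvg (n := n) hf hC Pn
  have hR1 : Integrable (fun w : Fin n → Z × Z => rademacherAvg fun j k => f j (w k).1) Q :=
    hm1.integrable_comp_of_integrable hRi
  have hR2 : Integrable (fun w : Fin n → Z × Z => rademacherAvg fun j k => f j (w k).2) Q :=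
    hm2.integrable_comp_of_integrable hRi
  calc ∫ z, ⨆ j, ∑ k, (∫ x, f j x ∂P - f j (z k)) ∂Pn
      ≤ ∫ w, D 1 w ∂Q := hghost
    _ = (2 ^ n : ℝ)⁻¹ * ∑ σ : Fin n → ℤˣ, ∫ w, D σ w ∂Q := by
        simp only [hswap]
        rw [Finset.sum_const, Finset.card_univ, card_signs, nsmul_eq_mul]
        simp
    _ = ∫ w, rademacherAvg (fun j k => f j (w k).2 - f j (w k).1) ∂Q := by
        simp only [rademacherAvg]
        rw [integral_const_mul, integral_finsetSum _ fun σ _ => hDi σ]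
    _ ≤ ∫ w, (rademacherAvg (fun j k => f j (w k).2)
          + rademacherAvg (fun j k => f j (w k).1)) ∂Q := by
        refine integral_mono ?_ (hR2.add hR1) fun w => rademacherAvg_sub_le _ _
        simp only [rademacherAvg]
        exact (integrable_finsetSum _ fun σ _ => hDi σ).const_mul _
    _ = 2 * ∫ z, rademacherAvg (fun j k => f j (z k)) ∂Pn := by
        rw [integral_add hR2 hR1, two_mul, integral_comp_measurePreserving hm1 hRm,
          integral_comp_measurePreserving hm2 hRm]

/-! ### Uniform deviation bounds -/

theorem abs_ciSup_sub_ciSup_le {ι : Type*} [Finite ι] [Nonempty ι] {f g : ι → ℝ} {c : ℝ}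
    (h : ∀ i, |f i - g i| ≤ c) : |(⨆ i, f i) - ⨆ i, g i| ≤ c := by
  rw [abs_sub_le_iff, sub_le_iff_le_add, sub_le_iff_le_add]
  refine ⟨ciSup_le fun i => ?_, ciSup_le fun i => ?_⟩
  · have := le_ciSup (bddAbove_range_of_finite g) i
    linarith [(abs_sub_le_iff.1 (h i)).1]
  · have := le_ciSup (bddAbove_range_of_finite f) i
    linarith [(abs_sub_le_iff.1 (h i)).2]

/-- Difference between the mean of `f` under `P` and its mean on the sample `z`. -/
noncomputable def deviation {Z : Type*} [MeasurableSpace Z] {n : ℕ} (P : Measure Z) (f : Z → ℝ)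
    (z : Fin n → Z) : ℝ :=
  ∫ x, f x ∂P - 1 / (n : ℝ) * ∑ k, f (z k)

/-- The difference of two deviations is the difference of a one-sided upper deviation and a
one-sided lower one. Treating the pair as one random variable avoids a union bound: a change of
one sample point moves it by at most `2 * M / n`. -/
theorem measureReal_deviation_sub_gt_le {ι Z : Type*} [MeasurableSpace Z] [Finite ι] [Nonempty ι]
    (P : Measure Z) [IsProbabilityMeasure P] {n : ℕ} (hn : 1 ≤ n) {f : ι → Z → ℝ}
    (hf : ∀ j, Measurable (f j)) {M Γ δ : ℝ} (hM0 : 0 < M) (h0 : ∀ i x, 0 ≤ f i x)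
    (hM : ∀ i x, f i x ≤ M)
    (hΓ : ∀ (z : Fin n → Z) t, t < M → ((levelTraces (Set.range f) z t).card : ℝ) ≤ Γ)
    (hδ₀ : 0 < δ) (hδ₁ : δ < 1) :
    (Measure.pi fun _ => P).real {z : Fin n → Z | ∃ i j,
      2 * M * Real.sqrt (2 * Real.log Γ / n) + 2 * M * Real.sqrt (Real.log (1 / δ) / (2 * n))
        < deviation P (f i) z - deviation P (f j) z} ≤ δ := by
  have hn0 : (0 : ℝ) < n := by exact_mod_cast hn
  have hlogδ : 0 ≤ Real.log (1 / δ) :=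
    Real.log_nonneg (by rw [one_div]; exact (one_le_inv₀ hδ₀).2 hδ₁.le)
  set g : ι × ι → Z → ℝ := fun q x => f q.1 x - f q.2 x with hg
  have hgm : ∀ q, Measurable (g q) := fun q => (hf _).sub (hf _)
  have hgM : ∀ q x, |g q x| ≤ M := fun q x => by
    rw [abs_le]
    constructor <;> simp only [hg] <;> linarith [h0 q.1 x, h0 q.2 x, hM q.1 x, hM q.2 x]
  have hEM : ∀ q, |∫ x, g q x ∂P| ≤ M := fun q => by
    simpa using norm_integral_le_of_norm_le_const (μ := P) (f := g q) (C := M)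
      (ae_of_all _ fun x => hgM q x)
  set F : (Fin n → Z) → ℝ := fun z => ⨆ q, ∑ k, (∫ x, g q x ∂P - g q (z k)) with hF
  have hFm : Measurable F := Measurable.iSup fun q => Finset.measurable_sum _ fun k _ =>
    ((hgm q).comp (measurable_pi_apply k)).const_sub _
  have hFC : ∀ z, |F z| ≤ n * (M + M) := fun z => abs_ciSup_le fun q =>
    abs_sum_le_of_abs_le fun k => (abs_sub _ _).trans (add_le_add (hEM _) (hgM _ _))
  have hFd : ∀ i z w, |F (Function.update z i w) - F z| ≤ 2 * M := by
    intro i z w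
    refine abs_ciSup_sub_ciSup_le fun q => ?_
    rw [← Finset.sum_sub_distrib, Finset.sum_eq_single i]
    · rw [Function.update_self]
      have e : ∫ x, g q x ∂P - g q w - (∫ x, g q x ∂P - g q (z i)) = g q (z i) - g q w := by ring
      rw [e, two_mul]
      exact (abs_sub _ _).trans (add_le_add (hgM _ _) (hgM _ _))
    · intro k _ hk
      rw [Function.update_of_ne hk, sub_self]
    · simp
  have hrad : ∀ z : Fin n → Z, rademacherAvg (fun q k => g q (z k))
      ≤ 2 * (M * Real.sqrt (n * Real.log Γ / 2)) := by
    intro z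
    have h1 := rademacherAvg_le_of_levelTraces f z hM0.le h0 hM (hΓ z)
    have h2 := rademacherAvg_sub_le (fun (q : ι × ι) k => f q.1 (z k)) fun q k => f q.2 (z k)
    have h3 := rademacherAvg_comp_le (fun i k => f i (z k)) (Prod.fst : ι × ι → ι)
    have h4 := rademacherAvg_comp_le (fun i k => f i (z k)) (Prod.snd : ι × ι → ι)
    simp only [hg]
    linarith
  have hEF : ∫ z, F z ∂(Measure.pi fun _ => P) ≤ 4 * M * Real.sqrt (n * Real.log Γ / 2) := by
    refine (integral_iSup_deviation_le P hgm hgM).trans ?_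
    have := integral_mono (integrable_rademacherAvg (n := n) hgm hgM (Measure.pi fun _ => P))
      (integrable_const _) hrad
    simp only [integral_const, probReal_univ, one_smul] at this
    linarith
  set s : ℝ := n * (2 * M * Real.sqrt (Real.log (1 / δ) / (2 * n))) with hs
  have htail := measureReal_pi_ge_le_of_bounded_differences P (c := 2 * M) (by positivity) F hFm _
    hFC hFd (s := s) (by positivity)
  have hexp : Real.exp (-s ^ 2 / (2 * (n * (2 * M / 2) ^ 2))) = δ := by
    have : -s ^ 2 / (2 * (n * (2 * M / 2) ^ 2)) = -Real.log (1 / δ) := by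
      rw [hs, mul_pow, mul_pow, Real.sq_sqrt (by positivity)]
      field_simp
    rw [this, one_div, Real.log_inv, neg_neg, Real.exp_log hδ₀]
  rw [hexp] at htail
  refine le_trans (measureReal_mono fun z hz => ?_) htail
  obtain ⟨i, j, hij⟩ := hz
  have hint : ∀ i, Integrable (f i) P := fun i =>
    .of_bound (C := M) (hf i).aestronglyMeasurable (ae_of_all _ fun x => by
      rw [Real.norm_of_nonneg (h0 i x)]; exact hM i x)
  have hle : ∑ k, (∫ x, g (i, j) x ∂P - g (i, j) (z k)) ≤ F z :=
    le_ciSup (f := fun q => ∑ k, (∫ x, g q x ∂P - g q (z k))) (bddAbove_range_of_finite _) (i, j)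
  have hdev : ∑ k, (∫ x, g (i, j) x ∂P - g (i, j) (z k))
      = n * (deviation P (f i) z - deviation P (f j) z) := by
    simp only [hg, deviation]
    rw [integral_sub (hint i) (hint j)]
    simp only [Finset.sum_sub_distrib, Finset.sum_const, Finset.card_univ, Fintype.card_fin,
      nsmul_eq_mul]
    field_simp
    ring
  have hsq : n * (2 * M * Real.sqrt (2 * Real.log Γ / n))
      = 4 * M * Real.sqrt (n * Real.log Γ / 2) := by
    have e1 : 2 * Real.log Γ / n = (2 / n) ^ 2 * (n * Real.log Γ / 2) := by field_simp
    rw [e1, Real.sqrt_mul (by positivity), Real.sqrt_sq (by positivity)]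
    field_simp; ring
  have hmul := mul_lt_mul_of_pos_left hij hn0
  rw [mul_add, hsq, ← hdev] at hmul
  simp only [Set.mem_ofPred_eq]
  linarith

/-- Uniform deviation bound along a sequence in a class of finite pseudo-dimension. -/
theorem measure_pi_exists_deviation_sub_gt_le {Z : Type*} [MeasurableSpace Z]
    (P : Measure Z) [IsProbabilityMeasure P] {n d : ℕ} (hn : 1 ≤ n) {F : Set (Z → ℝ)}
    (hd : pseudoDim F ≤ (d : ℕ∞)) (hdn : d ≤ n) {u : ℕ → Z → ℝ} (huF : ∀ i, u i ∈ F)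
    (hu : ∀ i, Measurable (u i)) {M δ : ℝ} (hM0 : 0 < M) (h0 : ∀ i x, 0 ≤ u i x)
    (hM : ∀ i, ∀ᵐ x ∂P, u i x ≤ M) (hδ₀ : 0 < δ) (hδ₁ : δ < 1) :
    (Measure.pi fun _ => P) {z : Fin n → Z | ∃ i j,
      excessBound M d n δ < deviation P (u i) z - deviation P (u j) z} ≤ ENNReal.ofReal δ := by
  -- clipping at `M` changes nothing almost everywhere and no superlevel set below `M`
  set v : ℕ → Z → ℝ := fun i x => min (u i x) M with hv
  have hvm : ∀ i, Measurable (v i) := fun i => (hu i).min measurable_const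
  have huv : ∀ i, u i =ᵐ[P] v i := fun i => by
    filter_upwards [hM i] with x hx using (min_eq_left hx).symm
  have hdev : ∀ᵐ z ∂(Measure.pi fun _ : Fin n => P), ∀ i,
      deviation P (u i) z = deviation P (v i) z := by
    have : ∀ᵐ z ∂(Measure.pi fun _ : Fin n => P), ∀ i, ∀ k, u i (z k) = v i (z k) :=
      ae_all_iff.2 fun i => ae_all_iff.2 fun k =>
        (measurePreserving_eval (fun _ : Fin n => P) k).quasiMeasurePreserving.ae (huv i)
    filter_upwards [this] with z hz i
    rw [deviation, deviation, integral_congr_ae (huv i)]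
    simp only [hz]
  set B : ℕ → Set (Fin n → Z) := fun m => {z | ∃ i j : Fin (m + 1),
    excessBound M d n δ < deviation P (v i) z - deviation P (v j) z} with hB
  have hBm : ∀ m, (Measure.pi fun _ => P) (B m) ≤ ENNReal.ofReal δ := by
    intro m
    have h := measureReal_deviation_sub_gt_le P hn (f := fun i : Fin (m + 1) => v i)
      (Γ := (Real.exp 1 * n / d) ^ d) (fun i => hvm i) hM0
      (fun i x => le_min (h0 i x) hM0.le) (fun i x => min_le_right _ _) (fun z t ht => ?_) hδ₀ hδ₁
    · rw [Real.log_pow, ← mul_assoc] at h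
      rw [← ofReal_measureReal]
      exact ENNReal.ofReal_le_ofReal h
    · refine le_trans (Nat.cast_le.2 (Finset.card_le_card fun T hT => ?_))
        (card_levelTraces_le hd hdn z t)
      obtain ⟨_, ⟨i, rfl⟩, hT⟩ := mem_levelTraces.1 hT
      exact mem_levelTraces.2 ⟨u i, huF i, fun k => (hT k).trans (by simp [hv, ht])⟩
  have hmono : Monotone B := fun a b hab z ⟨i, j, h⟩ =>
    ⟨i.castLE (by omega), j.castLE (by omega), h⟩
  calc (Measure.pi fun _ => P) {z : Fin n → Z | ∃ i j,
        excessBound M d n δ < deviation P (u i) z - deviation P (u j) z}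
      ≤ (Measure.pi fun _ => P) (⋃ m, B m) := by
        refine measure_mono_ae ?_
        filter_upwards [hdev] with z hz ⟨i, j, hij⟩
        rw [hz, hz] at hij
        exact Set.mem_iUnion.2 ⟨max i j, ⟨i, by omega⟩, ⟨j, by omega⟩, hij⟩
    _ = ⨆ m, (Measure.pi fun _ => P) (B m) := hmono.measure_iUnion
    _ ≤ ENNReal.ofReal δ := iSup_le hBm

/-! ### Bounds and continuity of the predictors -/

theorem summable_one_div_factorial_sq : Summable fun k : ℕ => 1 / ((k ! : ℝ)) ^ 2 := by
  refine Summable.of_nonneg_of_le (fun k => by positivity) (fun k => ?_)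
    (Real.summable_pow_div_factorial 1)
  rw [one_pow]
  have h1 : (1 : ℝ) ≤ k ! := by exact_mod_cast k.factorial_pos
  exact one_div_le_one_div_of_le (by positivity) (le_self_pow₀ h1 two_ne_zero)

theorem one_le_besselK : 1 ≤ besselK := by
  rw [besselK, Real.one_le_sqrt]
  simpa using summable_one_div_factorial_sq.le_tsum 0 fun k _ => by positivity

theorem norm_featureMap_le (N p : ℕ) {ξ : Fin N → ℝ} (hξ : ∀ i, |ξ i| ≤ 1) :
    ‖featureMap N p ξ‖ ≤ besselK ^ N := by
  have hS : 0 ≤ ∑' k : ℕ, 1 / ((k ! : ℝ)) ^ 2 := tsum_nonneg fun k => by positivity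
  refine le_of_sq_le_sq ?_ (by unfold besselK; positivity)
  rw [EuclideanSpace.norm_sq_eq, ← pow_mul, mul_comm, pow_mul, besselK, Real.sq_sqrt hS]
  calc ∑ α, ‖featureMap N p ξ α‖ ^ 2
      = ∑ α : Fin N → Fin (p + 1), ∏ i, (ξ i ^ (α i : ℕ) / ((α i : ℕ)! : ℝ)) ^ 2 := by
        refine Finset.sum_congr rfl fun α _ => ?_
        rw [Real.norm_eq_abs, sq_abs, featureMap, ← Finset.prod_pow]
    _ = ∏ i, ∑ a : Fin (p + 1), (ξ i ^ (a : ℕ) / ((a : ℕ)! : ℝ)) ^ 2 := by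
        rw [Finset.prod_univ_sum, Fintype.piFinset_univ]
    _ ≤ ∏ _i : Fin N, ∑' k : ℕ, 1 / ((k ! : ℝ)) ^ 2 := by
        refine Finset.prod_le_prod (fun i _ => by positivity) fun i _ => ?_
        calc ∑ a : Fin (p + 1), (ξ i ^ (a : ℕ) / ((a : ℕ)! : ℝ)) ^ 2
            ≤ ∑ a : Fin (p + 1), 1 / (((a : ℕ)! : ℝ)) ^ 2 := by
              refine Finset.sum_le_sum fun a _ => ?_
              rw [div_pow]
              gcongr
              rw [← pow_mul, mul_comm, pow_mul]
              exact pow_le_one₀ (sq_nonneg _) ((sq_le_one_iff_abs_le_one _).2 (hξ i))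
          _ = ∑ a ∈ Finset.range (p + 1), 1 / ((a ! : ℝ)) ^ 2 :=
              Fin.sum_univ_eq_sum_range (fun a : ℕ => 1 / ((a ! : ℝ)) ^ 2) (p + 1)
          _ ≤ ∑' k : ℕ, 1 / ((k ! : ℝ)) ^ 2 :=
              summable_one_div_factorial_sq.sum_le_tsum _ fun k _ => by positivity
    _ = (∑' k : ℕ, 1 / ((k ! : ℝ)) ^ 2) ^ N := by simp

theorem abs_predictor_le {N p : ℕ} {x₀ : Fin N → ℝ} {r Λ : ℝ} (hr : 0 < r) {A : Tensor N p}
    (hA : ‖A‖ ≤ Λ) (x : patch x₀ r) : |predictor x₀ r A x| ≤ Λ * besselK ^ N := by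
  have hK : 0 ≤ besselK ^ N := pow_nonneg (zero_le_one.trans one_le_besselK) _
  refine (abs_real_inner_le_norm _ _).trans (mul_le_mul hA (norm_featureMap_le N p fun i => ?_)
    (norm_nonneg _) ((norm_nonneg _).trans hA))
  rw [normCoord, abs_div, abs_of_pos hr, div_le_one hr]
  exact (norm_le_pi_norm ((x : Fin N → ℝ) - x₀) i).trans x.2

theorem continuous_predictor {N p : ℕ} (x₀ : Fin N → ℝ) (r : ℝ) (A : Tensor N p) :
    Continuous (predictor x₀ r A) := by
  unfold predictor featureMap normCoord
  refine continuous_const.inner ((PiLp.continuous_toLp 2 _).comp ?_)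
  refine continuous_pi fun α => continuous_finsetProd _ fun i _ => ?_
  have h : Continuous fun x : patch x₀ r => (x : Fin N → ℝ) i :=
    (continuous_apply i).comp continuous_subtype_val
  exact (((h.sub continuous_const).div_const r).pow _).div_const _

theorem continuous_predictor_apply {N p : ℕ} (x₀ : Fin N → ℝ) (r : ℝ) (x : patch x₀ r) :
    Continuous fun A : Tensor N p => predictor x₀ r A x :=
  continuous_id.inner continuous_const

/-! ### The regression model -/

/-- A mean-zero noise given `X` is uncorrelated with every bounded function of `X`. -/
theorem integral_comp_mul_eq_zero_of_condExp_eq_zero {Ω 𝒳 : Type*} [mΩ : MeasurableSpace Ω]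
    [m𝒳 : MeasurableSpace 𝒳] {μ : Measure Ω} [IsProbabilityMeasure μ] {X : Ω → 𝒳}
    (hX : Measurable X) {ε : Ω → ℝ} (hε : Integrable ε μ)
    (hcond : μ[ε | MeasurableSpace.comap X m𝒳] =ᵐ[μ] 0) {w : 𝒳 → ℝ} (hw : Measurable w) {C : ℝ}
    (hC : ∀ x, |w x| ≤ C) : ∫ ω, w (X ω) * ε ω ∂μ = 0 := by
  have hwX : StronglyMeasurable[MeasurableSpace.comap X m𝒳] (w ∘ X) :=
    (hw.comp (comap_measurable X)).stronglyMeasurable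
  have hint : Integrable ((w ∘ X) * ε) μ :=
    hε.bdd_mul (hw.comp hX).aestronglyMeasurable (ae_of_all _ fun ω => hC (X ω))
  have hpull := condExp_mul_of_stronglyMeasurable_left hwX hint hε
  calc ∫ ω, w (X ω) * ε ω ∂μ = ∫ ω, (μ[(w ∘ X) * ε | MeasurableSpace.comap X m𝒳]) ω ∂μ :=
        (integral_condExp hX.comap_le).symm
    _ = ∫ _, (0 : ℝ) ∂μ := by
        refine integral_congr_ae ?_
        filter_upwards [hpull, hcond] with ω h1 h2
        simp [h1, h2]
    _ = 0 := integral_zero _ _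

namespace IsLocalRegressionModel

variable {N n : ℕ} {x₀ : Fin N → ℝ} {r : ℝ} {Ω : Type*} [MeasurableSpace Ω] {μ : Measure Ω}
  {X : Fin n → Ω → patch x₀ r} {Y ε : Fin n → Ω → ℝ}
  {P : Measure (patch x₀ r × ℝ)} {g : patch x₀ r → ℝ} {Gmax σ : ℝ}

theorem measurable_pair (h : IsLocalRegressionModel μ X Y ε P g Gmax σ) (i : Fin n) :
    Measurable fun ω => (X i ω, Y i ω) :=
  (h.measurable_input i).prodMk (h.measurable_label i)

theorem targetBound_nonneg (h : IsLocalRegressionModel μ X Y ε P g Gmax σ) (hr : 0 < r) :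
    0 ≤ Gmax :=
  (abs_nonneg _).trans (h.target_bounded ⟨x₀, by simpa [patch] using hr.le⟩)

theorem ae_abs_label_le (h : IsLocalRegressionModel μ X Y ε P g Gmax σ) (i : Fin n) :
    ∀ᵐ z ∂P, |z.2| ≤ Gmax + σ := by
  rw [← h.law i, ae_map_iff (h.measurable_pair i).aemeasurable
    (measurableSet_le measurable_snd.abs measurable_const)]
  filter_upwards [h.label_eq i, h.noise_bounded i] with ω h1 h2
  rw [h1]
  exact (abs_add_le _ _).trans (add_le_add (h.target_bounded _) h2)

theorem ae_sq_sub_le (h : IsLocalRegressionModel μ X Y ε P g Gmax σ) (i : Fin n)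
    {f : patch x₀ r → ℝ} {B : ℝ} (hB : ∀ x, |f x| ≤ B) :
    ∀ᵐ z ∂P, (f z.1 - z.2) ^ 2 ≤ (B + (Gmax + σ)) ^ 2 := by
  filter_upwards [h.ae_abs_label_le i] with z hz
  have h1 := abs_le.1 (hB z.1)
  have h2 := abs_le.1 hz
  exact sq_le_sq' (by linarith) (by linarith)

variable [IsProbabilityMeasure μ]

theorem isProbabilityMeasure (h : IsLocalRegressionModel μ X Y ε P g Gmax σ) (i : Fin n) :
    IsProbabilityMeasure P :=
  h.law i ▸ Measure.isProbabilityMeasure_map (h.measurable_pair i).aemeasurable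

theorem map_sample (h : IsLocalRegressionModel μ X Y ε P g Gmax σ) :
    μ.map (fun ω i => (X i ω, Y i ω)) = Measure.pi fun _ => P := by
  rw [(iIndepFun_iff_map_fun_eq_pi_map fun i => (h.measurable_pair i).aemeasurable).1 h.indep]
  simp only [h.law]

theorem noiseBound_nonneg (h : IsLocalRegressionModel μ X Y ε P g Gmax σ) (i : Fin n) : 0 ≤ σ := by
  obtain ⟨ω, hω⟩ := (h.noise_bounded i).exists
  exact (abs_nonneg _).trans hω

/-- The population risk exceeds the clean risk by the noise variance, whatever the predictor. -/
theorem populationRisk_eq (h : IsLocalRegressionModel μ X Y ε P g Gmax σ) (i : Fin n)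
    {f : patch x₀ r → ℝ} (hf : Measurable f) {B : ℝ} (hB : ∀ x, |f x| ≤ B) :
    populationRisk P f = cleanRisk P g f + ∫ z, (g z.1 - z.2) ^ 2 ∂P := by
  have := h.isProbabilityMeasure i
  have hg := h.measurable_target
  set w : patch x₀ r → ℝ := fun x => f x - g x with hw
  have hwm : Measurable w := hf.sub hg
  have hwB : ∀ x, |w x| ≤ B + Gmax := fun x =>
    (abs_sub _ _).trans (add_le_add (hB x) (h.target_bounded x))
  have hlab := h.ae_abs_label_le i
  have hi1 : Integrable (fun z : patch x₀ r × ℝ => w z.1 ^ 2) P :=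
    .of_bound (C := (B + Gmax) ^ 2) ((hwm.comp measurable_fst).pow_const 2).aestronglyMeasurable
      (ae_of_all _ fun z => by rw [Real.norm_eq_abs, abs_pow]; gcongr; exact hwB _)
  have hi2 : Integrable (fun z : patch x₀ r × ℝ => (g z.1 - z.2) ^ 2) P :=
    .of_bound (C := (Gmax + (Gmax + σ)) ^ 2) (by fun_prop) (by
      filter_upwards [h.ae_sq_sub_le i h.target_bounded] with z hz
      rwa [Real.norm_of_nonneg (sq_nonneg _)])
  have hi3 : Integrable (fun z : patch x₀ r × ℝ => w z.1 * (g z.1 - z.2)) P :=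
    .of_bound (C := (B + Gmax) * (Gmax + (Gmax + σ))) (by fun_prop) (by
      filter_upwards [hlab] with z hz
      rw [Real.norm_eq_abs, abs_mul]
      exact mul_le_mul (hwB _) ((abs_sub _ _).trans (add_le_add (h.target_bounded _) hz))
        (abs_nonneg _) ((abs_nonneg _).trans (hwB z.1)))
  have hcross : ∫ z, w z.1 * (g z.1 - z.2) ∂P = 0 := by
    have hε : Integrable (ε i) μ := .of_bound (C := σ) (h.measurable_noise i).aestronglyMeasurable
      (h.noise_bounded i)
    have h0 := integral_comp_mul_eq_zero_of_condExp_eq_zero (h.measurable_input i) hε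
      (h.noise_unbiased i) hwm hwB
    rw [← h.law i, integral_map (h.measurable_pair i).aemeasurable (by fun_prop), ← neg_eq_zero,
      ← integral_neg, ← h0]
    refine integral_congr_ae ?_
    filter_upwards [h.label_eq i] with ω hω
    rw [hω]; ring
  have hclean : cleanRisk P g f = ∫ z, w z.1 ^ 2 ∂P := by
    rw [cleanRisk, Measure.fst, integral_map measurable_fst.aemeasurable (by fun_prop)]
  have hexp : ∀ z : patch x₀ r × ℝ, (f z.1 - z.2) ^ 2
      = w z.1 ^ 2 + 2 * (w z.1 * (g z.1 - z.2)) + (g z.1 - z.2) ^ 2 := fun z => by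
    simp only [hw]; ring
  rw [populationRisk, hclean]
  simp only [hexp]
  have hi13 : Integrable (fun z : patch x₀ r × ℝ => w z.1 ^ 2 + 2 * (w z.1 * (g z.1 - z.2))) P :=
    hi1.add (hi3.const_mul 2)
  rw [integral_add hi13 hi2, integral_add hi1 (hi3.const_mul 2),
    integral_const_mul, hcross, mul_zero, add_zero]

end IsLocalRegressionModel

end LocalTT

/-! ### Excess risk of empirical risk minimizers -/

theorem mainTheorem4 {N p n χ d : ℕ} (hN : 1 ≤ N) (hn : 1 ≤ n)
    {x₀ : Fin N → ℝ} {r Λ δ : ℝ} (hr : 0 < r) (hΛ : 0 < Λ) (hδ₀ : 0 < δ) (hδ₁ : δ < 1)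
    {Ω : Type*} [MeasurableSpace Ω] (μ : Measure Ω) [IsProbabilityMeasure μ]
    (X : Fin n → Ω → LocalTT.patch x₀ r) (Y ε : Fin n → Ω → ℝ)
    (P : Measure (LocalTT.patch x₀ r × ℝ)) (g : LocalTT.patch x₀ r → ℝ) (Gmax σ : ℝ)
    (hmodel : LocalTT.IsLocalRegressionModel μ X Y ε P g Gmax σ)
    (hd : LocalTT.pseudoDim
      (LocalTT.squaredLossClass (LocalTT.hypothesisClass p x₀ r Λ χ)) = (d : ℕ∞))
    (hdn : d ≤ n)
    (hhat : Ω → LocalTT.patch x₀ r → ℝ)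
    (hERM : ∀ᵐ ω ∂μ, LocalTT.IsERM (LocalTT.hypothesisClass p x₀ r Λ χ)
      (fun i => X i ω) (fun i => Y i ω) (hhat ω)) :
    ∃ E : Set Ω, MeasurableSet E ∧ ENNReal.ofReal (1 - δ) ≤ μ E ∧ ∀ ω ∈ E,
      LocalTT.populationRisk P (hhat ω)
          ≤ (⨅ h : LocalTT.hypothesisClass p x₀ r Λ χ, LocalTT.populationRisk P h)
            + LocalTT.excessBound ((Λ * LocalTT.besselK ^ N + (Gmax + σ)) ^ 2) d n δ ∧
      LocalTT.cleanRisk P g (hhat ω)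
          ≤ (⨅ h : LocalTT.hypothesisClass p x₀ r Λ χ, LocalTT.cleanRisk P g h)
            + LocalTT.excessBound ((Λ * LocalTT.besselK ^ N + (Gmax + σ)) ^ 2) d n δ := by
  have i₀ : Fin n := ⟨0, hn⟩
  have := hmodel.isProbabilityMeasure i₀
  set H := LocalTT.hypothesisClass p x₀ r Λ χ with hH
  set M : ℝ := (Λ * LocalTT.besselK ^ N + (Gmax + σ)) ^ 2 with hM
  set T := LocalTT.tensorClass N p Λ χ with hT
  have hM0 : 0 < M := by
    have h1 := hmodel.targetBound_nonneg hr
    have h2 := hmodel.noiseBound_nonneg i₀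
    have h3 : 0 < LocalTT.besselK := zero_lt_one.trans_le LocalTT.one_le_besselK
    positivity
  have hTne : Nonempty T := by
    obtain ⟨ω, hω⟩ := hERM.exists
    obtain ⟨A, hA, -⟩ := hω.1
    exact ⟨⟨A, hA⟩⟩
  let loss : T → LocalTT.patch x₀ r × ℝ → ℝ :=
    fun A z => (LocalTT.predictor x₀ r (A : LocalTT.Tensor N p) z.1 - z.2) ^ 2
  have hpm : ∀ A : T, Measurable (LocalTT.predictor x₀ r (A : LocalTT.Tensor N p)) := fun A =>
    (LocalTT.continuous_predictor x₀ r _).measurable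
  have hpb : ∀ (A : T) x, |LocalTT.predictor x₀ r (A : LocalTT.Tensor N p) x|
      ≤ Λ * LocalTT.besselK ^ N := fun A x => LocalTT.abs_predictor_le hr A.2.2 x
  have hlm : ∀ A, Measurable (loss A) := fun A =>
    (((hpm A).comp measurable_fst).sub measurable_snd).pow_const 2
  have hl0 : ∀ A z, 0 ≤ loss A z := fun A z => sq_nonneg _
  have hlM : ∀ A, ∀ᵐ z ∂P, loss A z ≤ M := fun A => hmodel.ae_sq_sub_le i₀ (hpb A)
  have hlc : ∀ z, Continuous fun A => loss A z := fun z =>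
    (((LocalTT.continuous_predictor_apply x₀ r z.1).comp continuous_subtype_val).sub
      continuous_const).pow 2
  have hdevc : ∀ z : Fin n → LocalTT.patch x₀ r × ℝ,
      Continuous fun A => LocalTT.deviation P (loss A) z := by
    intro z
    refine Continuous.sub ?_ (continuous_const.mul (continuous_finsetSum _ fun k _ => hlc _))
    exact continuous_of_dominated (bound := fun _ => M) (fun A => (hlm A).aestronglyMeasurable)
      (fun A => by filter_upwards [hlM A] with z hz; rwa [Real.norm_of_nonneg (hl0 A z)])
      (integrable_const _) (ae_of_all _ hlc)
  set b : ℝ := LocalTT.excessBound M d n δ with hb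
  let u : ℕ → T := TopologicalSpace.denseSeq T
  let bad : Set (Fin n → LocalTT.patch x₀ r × ℝ) := {z | ∃ i j,
    b < LocalTT.deviation P (loss (u i)) z - LocalTT.deviation P (loss (u j)) z}
  have hbad : (Measure.pi fun _ => P) bad ≤ ENNReal.ofReal δ :=
    LocalTT.measure_pi_exists_deviation_sub_gt_le P hn hd.le hdn
      (fun i => ⟨_, ⟨_, (u i).2, rfl⟩, rfl⟩) (fun i => hlm (u i)) hM0 (fun i => hl0 (u i))
      (fun i => hlM (u i)) hδ₀ hδ₁
  let S : Ω → Fin n → LocalTT.patch x₀ r × ℝ := fun ω i => (X i ω, Y i ω)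
  have hS : MeasurePreserving S μ (Measure.pi fun _ => P) :=
    ⟨measurable_pi_lambda _ fun i => hmodel.measurable_pair i, hmodel.map_sample⟩
  -- the event where `hhat` minimizes the empirical risk need not be measurable, as `hhat` is an
  -- arbitrary function of `ω`; measurable hulls of the exceptional sets have the same measure
  let bad' := toMeasurable (Measure.pi fun _ => P) bad
  let nul := toMeasurable μ {ω | ¬ LocalTT.IsERM H (fun i => X i ω) (fun i => Y i ω) (hhat ω)}
  have hbad'm : MeasurableSet (S ⁻¹' bad') := hS.measurable (measurableSet_toMeasurable _ _)
  have hEm : MeasurableSet (S ⁻¹' bad' ∪ nul) := hbad'm.union (measurableSet_toMeasurable _ _)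
  refine ⟨(S ⁻¹' bad' ∪ nul)ᶜ, hEm.compl, ?_, fun ω hω => ?_⟩
  · have hle : μ (S ⁻¹' bad' ∪ nul) ≤ ENNReal.ofReal δ := by
      refine (measure_union_le _ _).trans ?_
      rw [measure_toMeasurable, ae_iff.1 hERM, add_zero,
        hS.measure_preimage (measurableSet_toMeasurable _ _).nullMeasurableSet,
        measure_toMeasurable]
      exact hbad
    rw [prob_compl_eq_one_sub hEm, ENNReal.ofReal_sub _ hδ₀.le, ENNReal.ofReal_one]
    gcongr
  · rw [Set.mem_compl_iff, Set.mem_union, not_or] at hω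
    have hE : LocalTT.IsERM H (fun i => X i ω) (fun i => Y i ω) (hhat ω) := by
      by_contra hcon
      exact hω.2 (subset_toMeasurable _ _ hcon)
    -- from the dense sequence to the whole class, by continuity in the tensor
    have hunif : ∀ A B : T, LocalTT.deviation P (loss A) (S ω)
        - LocalTT.deviation P (loss B) (S ω) ≤ b := by
      refine isClosed_property2 (TopologicalSpace.denseRange_denseSeq T) ?_ fun i j => ?_
      · exact isClosed_le (((hdevc _).comp continuous_fst).sub ((hdevc _).comp continuous_snd))
          continuous_const
      · by_contra! hcon
        exact hω.1 (subset_toMeasurable _ _ ⟨i, j, hcon⟩)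
    obtain ⟨⟨A, hA, hAh⟩, hmin⟩ := hE
    have hpop : ∀ B : T, LocalTT.populationRisk P (hhat ω)
        ≤ LocalTT.populationRisk P (LocalTT.predictor x₀ r (B : LocalTT.Tensor N p)) + b := by
      intro B
      have h1 := hunif ⟨A, hA⟩ B
      have h2 := hmin _ ⟨B, B.2, rfl⟩
      rw [← hAh] at h2 ⊢
      simp only [LocalTT.deviation, LocalTT.empiricalRisk, LocalTT.populationRisk, loss, S]
        at h1 h2 ⊢
      linarith
    have hHne : Nonempty H := ⟨⟨_, A, hA, rfl⟩⟩
    constructor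
    · rw [← sub_le_iff_le_add]
      refine le_ciInf ?_
      rintro ⟨_, B, hB, rfl⟩
      exact sub_le_iff_le_add.2 (hpop ⟨B, hB⟩)
    · rw [← sub_le_iff_le_add]
      refine le_ciInf ?_
      rintro ⟨_, B, hB, rfl⟩
      have h1 := hpop ⟨B, hB⟩
      rw [← hAh, hmodel.populationRisk_eq i₀ (hpm ⟨A, hA⟩) (hpb ⟨A, hA⟩),
        hmodel.populationRisk_eq i₀ (hpm ⟨B, hB⟩) (hpb ⟨B, hB⟩)] at h1
      rw [← hAh]
      linarith
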